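/- All rings are associative with unity, and "ideal" means two-sided ideal. For a ring $R$, let $\mathcal{B}(R)$ be the set of central idempotents of $R$. If $X\subseteq Y$ are both left ideals or both right ideals of $R$, then $X$ is *ideal essential* in $Y$ if $X\cap I\neq 0$ for every nonzero ideal $I$ of $R$ with $I\subseteq Y$. The ring $R$ is *ideal extending* if for every ideal $X$ of $R$ there is an $e\in\mathcal{B}(R)$ such that $X\subseteq eR$ and $X$ is ideal essential in $eR$. **Theorem 2.17.** (1) Let $\{R_i\}_{i\in I}$ be a family of rings indexed by an arbitrary set $I$. Then $\prod_{i\in I}R_i$ is ideal extending if and only if $R_i$ is ideal extending for every $i\in I$. (2) The ideal extending property is a Morita invariant: if $R$ and $S$ are Morita equivalent rings (that is, their module categories are equivalent), then $R$ is ideal extending if and only if $S$ is ideal extending. -/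

import Mathlib

/-- The set `𝓑(R)` of central idempotents of a ring `R`. -/
def centralIdempotents (R : Type*) [Ring R] : Set R :=
  {e | e ∈ Set.center R ∧ IsIdempotentElem e}

/-- `X` is ideal essential in `Y`: `X ⊆ Y`, and every nonzero two-sided ideal `I` of `R` that is
contained in `Y` meets `X` in a nonzero element. The notion is meant for `X` and `Y` the underlying
sets of two left ideals or of two right ideals of `R`. -/
def IsIdealEssential {R : Type*} [Ring R] (X Y : Set R) : Prop :=
  X ⊆ Y ∧ ∀ I : TwoSidedIdeal R, I ≠ ⊥ → (I : Set R) ⊆ Y → ∃ x : R, x ∈ X ∧ x ∈ I ∧ x ≠ 0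

/-- A ring `R` is ideal extending if every two-sided ideal `X` of `R` is ideal essential in
the right ideal `eR = {e * r | r ∈ R}` for some central idempotent `e` of `R`. -/
def IsIdealExtending (R : Type*) [Ring R] : Prop :=
  ∀ X : TwoSidedIdeal R, ∃ e ∈ centralIdempotents R,
    IsIdealEssential (X : Set R) (Set.range fun r : R => e * r)

/-! The ideals `eR` with `e` a central idempotent are exactly the complemented two-sided ideals, so
being ideal extending is a property of the lattice of two-sided ideals. An equivalence of module
categories preserves that lattice: each ideal is the annihilator of a module, and `N.ann ≤ M.ann`
has the categorical form `IsQuotientOfCogenerated N M`. For products, central idempotents are chosen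
coordinatewise. -/

namespace TwoSidedIdeal

variable {R : Type*} [Ring R]

/-- The two-sided ideal `eR` generated by a central element `e`. -/
def ofCentral (e : R) (he : e ∈ Set.center R) : TwoSidedIdeal R :=
  .mk' (Set.range fun r : R => e * r) ⟨0, mul_zero e⟩
    (by rintro _ _ ⟨a, rfl⟩ ⟨b, rfl⟩; exact ⟨a + b, mul_add e a b⟩)
    (by rintro _ ⟨a, rfl⟩; exact ⟨-a, mul_neg e a⟩)
    (by
      rintro x _ ⟨a, rfl⟩
      refine ⟨x * a, ?_⟩
      change e * (x * a) = x * (e * a)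
      rw [← mul_assoc, ← mul_assoc, (Set.mem_center_iff.1 he).comm x])
    (by rintro _ y ⟨a, rfl⟩; exact ⟨a * y, (mul_assoc e a y).symm⟩)

theorem coe_ofCentral (e : R) (he : e ∈ Set.center R) :
    (ofCentral e he : Set R) = Set.range fun r : R => e * r :=
  coe_mk' ..

theorem mem_ofCentral {e : R} {he : e ∈ Set.center R} {x : R} :
    x ∈ ofCentral e he ↔ ∃ r, e * r = x := by
  rw [← SetLike.mem_coe, coe_ofCentral]; rfl

theorem isComplemented_ofCentral {e : R} (he : e ∈ Set.center R) (hi : IsIdempotentElem e) :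
    IsComplemented (ofCentral e he) := by
  have he' : 1 - e ∈ Set.center R := Semigroup.mem_center_iff.2 fun g => by
    rw [mul_sub, sub_mul, mul_one, one_mul, Semigroup.mem_center_iff.1 he g]
  refine ⟨ofCentral (1 - e) he', ?_, ?_⟩
  · rw [disjoint_iff, eq_bot_iff]
    intro x hx
    obtain ⟨h1, h2⟩ := (mem_inf _).1 hx
    obtain ⟨a, rfl⟩ := mem_ofCentral.1 h1
    obtain ⟨b, hb⟩ := mem_ofCentral.1 h2
    rw [mem_bot]
    have h : e * (e * a) = e * a := by rw [← mul_assoc, hi.eq]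
    rw [← h, ← hb, ← mul_assoc, mul_sub, mul_one, hi.eq, sub_self, zero_mul]
  · rw [codisjoint_iff, ← one_mem_iff, mem_sup]
    exact ⟨e, mem_ofCentral.2 ⟨1, mul_one e⟩, 1 - e, mem_ofCentral.2 ⟨1, mul_one _⟩,
      add_sub_cancel _ _⟩

/-- Write `1 = e + f` along `Y` and its complement `Z`. Products of `Y` with `Z` vanish, so `e` is a
two-sided identity of `Y`, and `r * e = e * r * e = e * r`. -/
theorem exists_eq_range_of_isComplemented {Y : TwoSidedIdeal R} (hY : IsComplemented Y) :
    ∃ e ∈ centralIdempotents R, (Y : Set R) = Set.range fun r : R => e * r := by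
  obtain ⟨Z, hd, hc⟩ := hY
  rw [codisjoint_iff, ← one_mem_iff, mem_sup] at hc
  obtain ⟨e, he, f, hf, hef⟩ := hc
  have hz : ∀ x, x ∈ Y → x ∈ Z → x = 0 := fun x h1 h2 => by
    have : x ∈ Y ⊓ Z := (mem_inf _).2 ⟨h1, h2⟩
    rwa [disjoint_iff.1 hd, mem_bot] at this
  have hl : ∀ y ∈ Y, e * y = y := fun y hy => by
    have := hz (f * y) (Y.mul_mem_left _ _ hy) (Z.mul_mem_right _ _ hf)
    calc e * y = (e + f) * y := by rw [add_mul, this, add_zero]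
      _ = y := by rw [hef, one_mul]
  have hr : ∀ y ∈ Y, y * e = y := fun y hy => by
    have := hz (y * f) (Y.mul_mem_right _ _ hy) (Z.mul_mem_left _ _ hf)
    calc y * e = y * (e + f) := by rw [mul_add, this, add_zero]
      _ = y := by rw [hef, mul_one]
  refine ⟨e, ⟨Semigroup.mem_center_iff.2 fun r => ?_, hl e he⟩, ?_⟩
  · rw [← hl (r * e) (Y.mul_mem_left _ _ he), ← mul_assoc, hr _ (Y.mul_mem_right _ _ he)]
  · ext y
    exact ⟨fun hy => ⟨y, hl y hy⟩, by rintro ⟨r, rfl⟩; exact Y.mul_mem_right _ _ he⟩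

theorem exists_mem_ne_zero {I : TwoSidedIdeal R} (hI : I ≠ ⊥) : ∃ x ∈ I, x ≠ 0 := by
  by_contra! h
  exact hI (eq_bot_iff.2 fun x hx => (mem_bot _).2 (h x hx))

theorem ne_bot_of_mem {I : TwoSidedIdeal R} {x : R} (hx : x ∈ I) (h0 : x ≠ 0) : I ≠ ⊥ := by
  rintro rfl
  exact h0 ((mem_bot _).1 hx)

end TwoSidedIdeal

/-- Being ideal extending only depends on the lattice of two-sided ideals. -/
theorem isIdealExtending_iff_lattice {R : Type*} [Ring R] :
    IsIdealExtending R ↔ ∀ X : TwoSidedIdeal R, ∃ Y : TwoSidedIdeal R,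
      IsComplemented Y ∧ X ≤ Y ∧ ∀ I ≤ Y, I ≠ ⊥ → X ⊓ I ≠ ⊥ := by
  refine forall_congr' fun X => ⟨?_, ?_⟩
  · rintro ⟨e, ⟨he, hi⟩, hX, hess⟩
    refine ⟨.ofCentral e he, TwoSidedIdeal.isComplemented_ofCentral he hi, ?_, ?_⟩
    · rwa [TwoSidedIdeal.le_iff, TwoSidedIdeal.coe_ofCentral]
    · intro I hI h0
      rw [TwoSidedIdeal.le_iff, TwoSidedIdeal.coe_ofCentral] at hI
      obtain ⟨x, hx, hxI, hx0⟩ := hess I h0 hI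
      exact TwoSidedIdeal.ne_bot_of_mem ((TwoSidedIdeal.mem_inf _).2 ⟨hx, hxI⟩) hx0
  · rintro ⟨Y, hY, hXY, hess⟩
    obtain ⟨e, he, hYe⟩ := TwoSidedIdeal.exists_eq_range_of_isComplemented hY
    refine ⟨e, he, hYe ▸ hXY, fun I h0 hI => ?_⟩
    obtain ⟨x, hx, hx0⟩ := TwoSidedIdeal.exists_mem_ne_zero (hess I (by rwa [TwoSidedIdeal.le_iff, hYe]) h0)
    obtain ⟨h1, h2⟩ := (TwoSidedIdeal.mem_inf _).1 hx
    exact ⟨x, h1, h2, hx0⟩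

theorem IsIdealExtending.of_orderIso {R S : Type*} [Ring R] [Ring S]
    (φ : TwoSidedIdeal R ≃o TwoSidedIdeal S) (h : IsIdealExtending R) : IsIdealExtending S := by
  rw [isIdealExtending_iff_lattice] at h ⊢
  intro X
  obtain ⟨Y, ⟨Z, hYZ⟩, hXY, hess⟩ := h (φ.symm X)
  refine ⟨φ Y, ⟨φ Z, φ.isCompl_iff.1 hYZ⟩, φ.symm_apply_le.1 hXY, fun I hI h0 hXI => ?_⟩
  refine hess (φ.symm I) (φ.symm_apply_le.2 hI) (by simpa using h0) ?_
  rw [← map_inf, hXI, map_bot]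

/-! ### Products of rings -/

section Pi

variable {ι : Type*} {R : ι → Type*} [∀ i, Ring (R i)]

/-- The projection of a two-sided ideal of a product ring to a factor. -/
def TwoSidedIdeal.piProj (X : TwoSidedIdeal (∀ i, R i)) (i : ι) : TwoSidedIdeal (R i) := by
  classical
  exact .mk' {a | ∃ x ∈ X, x i = a} ⟨0, X.zero_mem, rfl⟩
    (by rintro _ _ ⟨x, hx, rfl⟩ ⟨y, hy, rfl⟩; exact ⟨x + y, X.add_mem hx hy, rfl⟩)
    (by rintro _ ⟨x, hx, rfl⟩; exact ⟨-x, X.neg_mem hx, rfl⟩)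
    (by
      rintro a _ ⟨x, hx, rfl⟩
      exact ⟨Pi.single i a * x, X.mul_mem_left _ _ hx, by simp⟩)
    (by
      rintro _ a ⟨x, hx, rfl⟩
      exact ⟨x * Pi.single i a, X.mul_mem_right _ _ hx, by simp⟩)

theorem TwoSidedIdeal.mem_piProj {X : TwoSidedIdeal (∀ i, R i)} {i : ι} {a : R i} :
    a ∈ X.piProj i ↔ ∃ x ∈ X, x i = a :=
  mem_mk' ..

/-- The extension by zero of a two-sided ideal of a factor to the product ring. -/
def TwoSidedIdeal.piSingle {i : ι} (X : TwoSidedIdeal (R i)) : TwoSidedIdeal (∀ i, R i) :=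
  .mk' {x | x i ∈ X ∧ ∀ j ≠ i, x j = 0} ⟨X.zero_mem, fun _ _ => rfl⟩
    (fun hx hy => ⟨X.add_mem hx.1 hy.1, fun j hj => by simp [hx.2 j hj, hy.2 j hj]⟩)
    (fun hx => ⟨X.neg_mem hx.1, fun j hj => by simp [hx.2 j hj]⟩)
    (fun hx => ⟨X.mul_mem_left _ _ hx.1, fun j hj => by simp [hx.2 j hj]⟩)
    (fun hx => ⟨X.mul_mem_right _ _ hx.1, fun j hj => by simp [hx.2 j hj]⟩)

theorem TwoSidedIdeal.mem_piSingle {i : ι} {X : TwoSidedIdeal (R i)} {x : ∀ i, R i} :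
    x ∈ X.piSingle ↔ x i ∈ X ∧ ∀ j ≠ i, x j = 0 :=
  mem_mk' ..

theorem mem_centralIdempotents_pi {e : ∀ i, R i} :
    e ∈ centralIdempotents (∀ i, R i) ↔ ∀ i, e i ∈ centralIdempotents (R i) := by
  classical
  simp only [centralIdempotents, Set.mem_ofPred_eq, forall_and, IsIdempotentElem, funext_iff,
    Pi.mul_apply, Semigroup.mem_center_iff]
  refine and_congr_left fun _ => ⟨fun h i a => ?_, fun h g i => h i (g i)⟩
  simpa using h (Pi.single i a) i

theorem IsIdealExtending.pi (h : ∀ i, IsIdealExtending (R i)) : IsIdealExtending (∀ i, R i) := by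
  classical
  intro X
  choose e he hX hess using fun i => h i (X.piProj i)
  refine ⟨e, mem_centralIdempotents_pi.2 he, fun x hx => ?_, fun I h0 hI => ?_⟩
  · choose r hr using fun i => hX i (TwoSidedIdeal.mem_piProj.2 ⟨x, hx, rfl⟩)
    exact ⟨r, funext hr⟩
  · obtain ⟨a, ha, ha0⟩ := TwoSidedIdeal.exists_mem_ne_zero h0
    obtain ⟨i, hi⟩ := Function.ne_iff.1 ha0
    obtain ⟨b, hbX, hbI, hb0⟩ := hess i (I.piProj i)
      (TwoSidedIdeal.ne_bot_of_mem (TwoSidedIdeal.mem_piProj.2 ⟨a, ha, rfl⟩) hi) (by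
        rintro _ hb
        obtain ⟨y, hy, rfl⟩ := TwoSidedIdeal.mem_piProj.1 hb
        obtain ⟨r, rfl⟩ := hI hy
        exact ⟨r i, rfl⟩)
    -- Multiplying a preimage of `b` by the idempotent `Pi.single i 1` kills all other coordinates.
    have key : ∀ J : TwoSidedIdeal (∀ i, R i), b ∈ J.piProj i → Pi.single i b ∈ J := by
      intro J hb
      obtain ⟨y, hy, rfl⟩ := TwoSidedIdeal.mem_piProj.1 hb
      have := J.mul_mem_left (Pi.single i 1) y hy
      rwa [← Pi.single_mul_left, one_mul] at this
    exact ⟨Pi.single i b, key X hbX, key I hbI, by simpa using hb0⟩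

theorem IsIdealExtending.of_pi (h : IsIdealExtending (∀ i, R i)) (i : ι) :
    IsIdealExtending (R i) := by
  classical
  intro X
  have single_mem : ∀ {J : TwoSidedIdeal (R i)} {x : R i}, x ∈ J → Pi.single i x ∈ J.piSingle :=
    fun hx => TwoSidedIdeal.mem_piSingle.2 ⟨by simpa using hx, fun j hj => by simp [hj]⟩
  obtain ⟨e, he, hX, hess⟩ := h X.piSingle
  refine ⟨e i, mem_centralIdempotents_pi.1 he i, fun x hx => ?_, fun I h0 hI => ?_⟩
  · obtain ⟨r, hr⟩ := hX (single_mem hx)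
    exact ⟨r i, by simpa using congrFun hr i⟩
  · obtain ⟨a, ha, ha0⟩ := TwoSidedIdeal.exists_mem_ne_zero h0
    obtain ⟨y, hyX, hyI, hy0⟩ := hess I.piSingle
      (TwoSidedIdeal.ne_bot_of_mem (single_mem ha) (by simpa using ha0)) (by
        intro y hy
        obtain ⟨h1, h2⟩ := TwoSidedIdeal.mem_piSingle.1 hy
        obtain ⟨r, hr⟩ := hI h1
        refine ⟨Pi.single i r, funext fun j => ?_⟩
        by_cases hj : j = i
        · subst hj; simpa using hr
        · simp [hj, h2 j hj])
    obtain ⟨h1, h2⟩ := TwoSidedIdeal.mem_piSingle.1 hyX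
    refine ⟨y i, h1, (TwoSidedIdeal.mem_piSingle.1 hyI).1, fun hi => hy0 (funext fun j => ?_)⟩
    by_cases hj : j = i
    · subst hj; exact hi
    · exact h2 j hj

end Pi

/-! ### Morita invariance of the ideal lattice -/

namespace CategoryTheory

universe v₁ v₂ u₁ u₂

variable {C : Type u₁} [Category.{v₁} C] {D : Type u₂} [Category.{v₂} D]

/-- `M` is a quotient of an object cogenerated by `N`. -/
def IsQuotientOfCogenerated (N M : C) : Prop :=
  ∃ (P : C) (g : P ⟶ M), Epi g ∧ ∀ (Q : C) (u v : Q ⟶ P), (∀ f : P ⟶ N, u ≫ f = v ≫ f) → u = v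

theorem IsQuotientOfCogenerated.map (F : C ≌ D) {N M : C} (h : IsQuotientOfCogenerated N M) :
    IsQuotientOfCogenerated (F.functor.obj N) (F.functor.obj M) := by
  obtain ⟨P, g, hg, hP⟩ := h
  refine ⟨F.functor.obj P, F.functor.map g, inferInstance, fun Q u v huv => ?_⟩
  obtain ⟨u', hu⟩ := F.functor.map_surjective ((F.counitIso.app Q).hom ≫ u)
  obtain ⟨v', hv⟩ := F.functor.map_surjective ((F.counitIso.app Q).hom ≫ v)
  have : u' = v' := hP _ u' v' fun f => F.functor.map_injective (by
    rw [Functor.map_comp, Functor.map_comp, hu, hv, Category.assoc, Category.assoc, huv])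
  rw [← cancel_epi (F.counitIso.app Q).hom, ← hu, ← hv, this]

theorem IsQuotientOfCogenerated.of_iso {N M M' : C} (h : IsQuotientOfCogenerated N M)
    (i : M ≅ M') : IsQuotientOfCogenerated N M' := by
  obtain ⟨P, g, hg, hP⟩ := h
  exact ⟨P, g ≫ i.hom, epi_comp _ _, hP⟩

end CategoryTheory

namespace ModuleCat

open CategoryTheory

universe u v

variable {R : Type u} [Ring R]

/-- The annihilator of a module, as a two-sided ideal. -/
def ann (M : ModuleCat.{v} R) : TwoSidedIdeal R := (Module.annihilator R M).toTwoSided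

theorem mem_ann {M : ModuleCat.{v} R} {r : R} : r ∈ M.ann ↔ ∀ m : M, r • m = 0 := by
  rw [ann, Ideal.mem_toTwoSided, Module.mem_annihilator]

theorem ann_le_ann_of_iso {M N : ModuleCat.{v} R} (i : M ≅ N) : M.ann ≤ N.ann := by
  intro r hr
  refine mem_ann.2 fun n => ?_
  obtain ⟨m, rfl⟩ := i.toLinearEquiv.surjective n
  rw [← map_smul, mem_ann.1 hr, map_zero]

theorem ann_le_ann_of_isQuotientOfCogenerated {M N : ModuleCat.{v} R}
    (h : IsQuotientOfCogenerated N M) : N.ann ≤ M.ann := by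
  obtain ⟨P, g, hg, hP⟩ := h
  have hker : ∀ p : P, (∀ f : P ⟶ N, f.hom p = 0) → p = 0 := by
    intro p hp
    -- No map to `N` separates the inclusion of `K` from zero, so `K = 0`.
    let K : Submodule R P := ⨅ f : P ⟶ N, LinearMap.ker f.hom
    have := hP (ModuleCat.of R K) (ModuleCat.ofHom K.subtype) 0 fun f => by
      ext x
      simpa using (Submodule.mem_iInf _).1 x.2 f
    have hpK : p ∈ K := (Submodule.mem_iInf _).2 hp
    simpa using congrArg (fun φ => φ.hom ⟨p, hpK⟩) this
  intro r hr
  refine mem_ann.2 fun m => ?_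
  obtain ⟨p, rfl⟩ := (ModuleCat.epi_iff_surjective g).1 hg m
  rw [← map_smul, hker (r • p) fun f => by rw [map_smul, mem_ann.1 hr], map_zero]

/-- With `A` the annihilator of `N`, a direct sum of copies of `R ⧸ A` covers `M`, since `A` kills
`M`. The maps `1 ↦ n` into `N` separate the points of `R ⧸ A`. -/
theorem isQuotientOfCogenerated_of_ann_le_ann {M N : ModuleCat.{max u v} R}
    (h : N.ann ≤ M.ann) : IsQuotientOfCogenerated N M := by
  let A : Ideal R := Module.annihilator R N
  have lift : ∀ {L : ModuleCat.{max u v} R} (_ : N.ann ≤ L.ann) (x : L),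
      ∃ f : R ⧸ A →ₗ[R] L, ∀ r : R, f (Submodule.Quotient.mk r) = r • x := fun {L} hL x =>
    ⟨A.liftQ (LinearMap.toSpanSingleton R L x) fun r hr =>
      mem_ann.1 (hL (Ideal.mem_toTwoSided.2 hr)) x, fun r => rfl⟩
  choose φ hφ using fun m : M => lift h m
  choose ψ hψ using fun n : N => lift le_rfl n
  refine ⟨ModuleCat.of R (M →₀ R ⧸ A), ModuleCat.ofHom (Finsupp.lsum ℕ φ), ?_, ?_⟩
  · refine (ModuleCat.epi_iff_surjective _).2 fun m =>
      ⟨Finsupp.single m (Submodule.Quotient.mk 1), ?_⟩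
    simpa using hφ m 1
  · intro Q a b hab
    refine ModuleCat.hom_ext (LinearMap.ext fun q => Finsupp.ext fun m => sub_eq_zero.1 ?_)
    obtain ⟨r, hr⟩ := Submodule.Quotient.mk_surjective A (a.hom q m - b.hom q m)
    rw [← hr, Submodule.Quotient.mk_eq_zero]
    refine Module.mem_annihilator.2 fun n => ?_
    rw [← hψ, hr, map_sub, sub_eq_zero]
    exact congrArg (fun f => f.hom q) (hab (ModuleCat.ofHom (ψ n ∘ₗ Finsupp.lapply m)))

theorem isQuotientOfCogenerated_iff {M N : ModuleCat.{max u v} R} :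
    IsQuotientOfCogenerated N M ↔ N.ann ≤ M.ann :=
  ⟨ann_le_ann_of_isQuotientOfCogenerated, isQuotientOfCogenerated_of_ann_le_ann.{u, v}⟩

/-- The quotient of `R` by a two-sided ideal, as an object of a category of large modules. -/
def quotientTwoSided (I : TwoSidedIdeal R) : ModuleCat.{max u v} R :=
  ModuleCat.of R (ULift.{v} (R ⧸ I.asIdeal))

theorem ann_quotientTwoSided (I : TwoSidedIdeal R) : (quotientTwoSided.{u, v} I).ann = I := by
  ext r
  rw [mem_ann]
  constructor
  · intro h
    have := congrArg ULift.down (h ⟨Submodule.Quotient.mk 1⟩)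
    change Submodule.Quotient.mk (r • (1 : R)) = 0 at this
    rw [Submodule.Quotient.mk_eq_zero] at this
    simpa using this
  · rintro h ⟨x⟩
    obtain ⟨x, rfl⟩ := Submodule.Quotient.mk_surjective _ x
    refine ULift.ext _ _ ?_
    change Submodule.Quotient.mk (r • x) = 0
    rw [Submodule.Quotient.mk_eq_zero]
    exact I.mul_mem_right _ _ h

variable {S : Type v} [Ring S]

theorem ann_functor_le_iff (F : ModuleCat.{max u v} R ≌ ModuleCat.{max u v} S)
    {M N : ModuleCat.{max u v} R} :
    (F.functor.obj N).ann ≤ (F.functor.obj M).ann ↔ N.ann ≤ M.ann := by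
  rw [← isQuotientOfCogenerated_iff.{u, v}, ← isQuotientOfCogenerated_iff.{v, u}]
  refine ⟨fun h => ?_, fun h => h.map F⟩
  rw [isQuotientOfCogenerated_iff.{u, v}]
  exact (ann_le_ann_of_iso (F.unitIso.app N)).trans <|
    (isQuotientOfCogenerated_iff.{u, v}.1 (h.map F.symm)).trans
      (ann_le_ann_of_iso (F.unitIso.symm.app M))

/-- An equivalence of module categories induces an isomorphism of the lattices of two-sided
ideals. -/
noncomputable def twoSidedIdealOrderIso (F : ModuleCat.{max u v} R ≌ ModuleCat.{max u v} S) :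
    TwoSidedIdeal R ≃o TwoSidedIdeal S :=
  RelIso.ofSurjective
    (OrderEmbedding.ofMapLEIff
      (fun I => (F.functor.obj (quotientTwoSided.{u, v} I)).ann) fun I J => by
        rw [ann_functor_le_iff, ann_quotientTwoSided, ann_quotientTwoSided])
    (fun J => by
      let N := F.inverse.obj (quotientTwoSided.{v, u} J)
      refine ⟨N.ann, ?_⟩
      change (F.functor.obj (quotientTwoSided.{u, v} N.ann)).ann = J
      have hN : (F.functor.obj N).ann = J :=
        (le_antisymm (ann_le_ann_of_iso (F.counitIso.app _))
          (ann_le_ann_of_iso (F.counitIso.symm.app _))).trans (ann_quotientTwoSided J)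
      -- `N` and the quotient of `R` by `N.ann` have equal annihilators, hence so do their images
      -- under `F`.
      rw [← hN]
      exact le_antisymm ((ann_functor_le_iff F).2 (ann_quotientTwoSided _).le)
        ((ann_functor_le_iff F).2 (ann_quotientTwoSided _).ge))

end ModuleCat

theorem IsIdealExtending.of_isMoritaEquivalent {R S : Type*} [Ring R] [Ring S]
    (h : IsMoritaEquivalent ℤ R S) (hR : IsIdealExtending R) : IsIdealExtending S := by
  obtain ⟨e⟩ := h.cond
  exact hR.of_orderIso (ModuleCat.twoSidedIdealOrderIso e.eqv)

theorem theorem2p17 :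
    (∀ (ι : Type*) (R : ι → Type*) [∀ i, Ring (R i)],
      IsIdealExtending (∀ i, R i) ↔ ∀ i, IsIdealExtending (R i)) ∧
    (∀ (R : Type*) (S : Type*) [Ring R] [Ring S],
      IsMoritaEquivalent ℤ R S → (IsIdealExtending R ↔ IsIdealExtending S)) :=
  ⟨fun _ _ _ => ⟨fun h i => h.of_pi i, .pi⟩,
    fun _ _ _ _ h => ⟨.of_isMoritaEquivalent h, .of_isMoritaEquivalent (h.symm ℤ)⟩⟩
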